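/- All vector spaces are real. For a Riesz space $E$, let $E^{\sim}$ be its order dual, i.e. the Riesz space of order bounded linear functionals on $E$ (with $f\le g$ iff $f(x)\le g(x)$ for all $x\ge 0$), and $E^{\sim\sim}=(E^{\sim})^{\sim}$. For Riesz spaces $E_1,\dots,E_m,F$, let $\mathcal L_r(E_1,\dots,E_m;F)$ be the space of regular $m$-linear operators $E_1\times\cdots\times E_m\to F$, i.e. differences of two positive $m$-linear operators. An operator $A\in\mathcal L_r(E_1,\dots,E_m;F)$ is of finite type if there are $n\in\mathbb N$, functionals $\varphi_j^i\in E_i^{\sim}$ and vectors $y_j\in F$ ($1\le j\le n$, $1\le i\le m$) with $$A(x_1,\dots,x_m)=\sum_{j=1}^n \varphi_j^1(x_1)\cdots\varphi_j^m(x_m)\,y_j\qquad\text{for all } x_i\in E_i .$$ For a permutation $\rho$ of $\{1,\dots,m\}$, the Arens extension $AR_m^\rho(A)\colon E_1^{\sim\sim}\times\cdots\times E_m^{\sim\sim}\to F^{\sim\sim}$ of $A\in\mathcal L_r(E_1,\dots,E_m;F)$ with respect to $\rho$ is the regular $m$-linear operator given by $$AR_m^\rho(A)(x_1'',\dots,x_m'')(y')=\big(\overline{x_{\rho(m)}''}^{\,\rho}\circ\cdots\circ\overline{x_{\rho(1)}''}^{\,\rho}\big)(y'\circ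 A),\qquad y'\in F^{\sim},$$ where $\overline{x_{\rho(k)}''}^{\,\rho}$ sends a regular form $B$ in the variables $x_{\rho(k)},x_{\rho(k+1)},\dots,x_{\rho(m)}$ to the regular form in the variables $x_{\rho(k+1)},\dots,x_{\rho(m)}$ whose value is $x_{\rho(k)}''$ applied to the functional $x_{\rho(k)}\mapsto B(x_{\rho(k)},\dots,x_{\rho(m)})$ in $E_{\rho(k)}^{\sim}$ (for $k=m$ the result is a real number). A net $(x_\alpha)_{\alpha\in\Omega}$ in a Riesz space is order convergent to $x$ if there is a net $(y_\alpha)_{\alpha\in\Omega}$ with $y_\alpha\downarrow 0$ (decreasing with infimum $0$) and $|x_\alpha-x|\le y_\alpha$ for all $\alpha\in\Omega$. A linear operator is order continuous if it maps nets order convergent to $0$ to nets order convergent to $0$. An $m$-linear operator is separately order continuous if, for every $j$ and every choice of the other variables, it is order continuous as a linear operator of the $j$-th variable. **Corollary.** Let $E_1,\dots,E_m,F$ be Riesz spaces and let $A\in\mathcal L_r(E_1,\dots,E_m;F)$ be of finite type. Then all Arens extensions of $A$ coincide, i.e. $AR_m^\rho(A)=AR_m^\sigma(A)$ for all permutations $\rho,\sigma$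 of $\{1,\dots,m\}$; and, for every $\rho$, the operator $AR_m^\rho(A)$ is of finite type (as an element of $\mathcal L_r(E_1^{\sim\sim},\dots,E_m^{\sim\sim};F^{\sim\sim})$) and separately order continuous on $E_1^{\sim\sim}\times\cdots\times E_m^{\sim\sim}$. -/

import Mathlib

set_option linter.unusedSectionVars false

universe u v w

noncomputable section

namespace Riesz

/-! ### The order dual of a Riesz space

A (real) Riesz space is a real vector space with a lattice order such that the order is compatible
with addition (`IsOrderedAddMonoid`) and with multiplication by nonnegative scalars
(`IsOrderedModule ℝ`). -/

section Dual

variable (E : Type u) [AddCommGroup E] [Lattice E] [IsOrderedAddMonoid E] [Module ℝ E]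
  [IsOrderedModule ℝ E]

/-- The space of order bounded linear functionals on `E`: those which map every order interval
`[a, b]` to a bounded set of real numbers. -/
def orderBoundedFunctionals : Submodule ℝ (E →ₗ[ℝ] ℝ) where
  carrier := {f | ∀ a b : E, ∃ C : ℝ, ∀ x ∈ Set.Icc a b, |f x| ≤ C}
  zero_mem' := fun _ _ => ⟨0, fun _ _ => by simp⟩
  add_mem' := by
    intro f g hf hg a b
    obtain ⟨C, hC⟩ := hf a b
    obtain ⟨D, hD⟩ := hg a b
    exact ⟨C + D, fun x hx => (abs_add_le _ _).trans (add_le_add (hC x hx) (hD x hx))⟩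
  smul_mem' := by
    intro c f hf a b
    obtain ⟨C, hC⟩ := hf a b
    refine ⟨|c| * C, fun x hx => ?_⟩
    simp only [LinearMap.smul_apply, smul_eq_mul, abs_mul]
    exact mul_le_mul_of_nonneg_left (hC x hx) (abs_nonneg c)

/-- The order dual `E^∼` of a Riesz space `E`. -/
def OrdDual : Type u := orderBoundedFunctionals E

namespace OrdDual

instance : AddCommGroup (OrdDual E) := inferInstanceAs (AddCommGroup (orderBoundedFunctionals E))

instance : Module ℝ (OrdDual E) := inferInstanceAs (Module ℝ (orderBoundedFunctionals E))

variable {E}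

/-- The linear functional underlying an element of the order dual. -/
def toLin : OrdDual E →ₗ[ℝ] (E →ₗ[ℝ] ℝ) := (orderBoundedFunctionals E).subtype

instance : FunLike (OrdDual E) E ℝ where
  coe f := toLin f
  coe_injective := fun _ _ h => Subtype.ext (DFunLike.coe_injective h)

instance : LinearMapClass (OrdDual E) ℝ E ℝ where
  map_add f := (toLin f).map_add
  map_smulₛₗ f := (toLin f).map_smul

theorem toLin_apply (f : OrdDual E) (x : E) : toLin f x = f x := rfl

@[ext] theorem ext {f g : OrdDual E} (h : ∀ x, f x = g x) : f = g := DFunLike.ext _ _ h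

/-- An order bounded linear functional, as an element of the order dual. -/
def mk (f : E →ₗ[ℝ] ℝ) (hf : ∀ a b : E, ∃ C : ℝ, ∀ x ∈ Set.Icc a b, |f x| ≤ C) : OrdDual E :=
  ⟨f, hf⟩

@[simp] theorem mk_apply (f : E →ₗ[ℝ] ℝ) (hf) (x : E) : mk f hf x = f x := rfl
@[simp] theorem add_apply (f g : OrdDual E) (x : E) : (f + g) x = f x + g x := rfl
@[simp] theorem sub_apply (f g : OrdDual E) (x : E) : (f - g) x = f x - g x := rfl
@[simp] theorem neg_apply (f : OrdDual E) (x : E) : (-f) x = -f x := rfl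
@[simp] theorem zero_apply (x : E) : (0 : OrdDual E) x = 0 := rfl
@[simp] theorem smul_apply (c : ℝ) (f : OrdDual E) (x : E) : (c • f) x = c * f x := rfl

theorem bounded (f : OrdDual E) (a b : E) : ∃ C : ℝ, ∀ x ∈ Set.Icc a b, |f x| ≤ C := f.2 a b

theorem eq_of_nonneg {f g : OrdDual E} (h : ∀ x, 0 ≤ x → f x = g x) : f = g := by
  ext x
  rw [← posPart_sub_negPart x, map_sub, map_sub, h _ (posPart_nonneg x), h _ (negPart_nonneg x)]

/-- `f ≤ g` means `f x ≤ g x` for all `x ≥ 0`. -/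
instance : PartialOrder (OrdDual E) where
  le f g := ∀ x : E, 0 ≤ x → f x ≤ g x
  le_refl _ _ _ := le_rfl
  le_trans _ _ _ h₁ h₂ x hx := (h₁ x hx).trans (h₂ x hx)
  le_antisymm _ _ h₁ h₂ := eq_of_nonneg fun x hx => le_antisymm (h₁ x hx) (h₂ x hx)

theorem le_def {f g : OrdDual E} : f ≤ g ↔ ∀ x : E, 0 ≤ x → f x ≤ g x := Iff.rfl

theorem mono {f : OrdDual E} (hf : 0 ≤ f) {x y : E} (h : x ≤ y) : f x ≤ f y := by
  have := hf (y - x) (sub_nonneg.2 h)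
  rw [zero_apply, map_sub] at this
  linarith

instance : IsOrderedAddMonoid (OrdDual E) where
  add_le_add_left f g h k x hx := by
    simpa using h x hx

instance : IsOrderedModule ℝ (OrdDual E) where
  smul_le_smul_of_nonneg_left c hc f g h x hx := by
    simpa using mul_le_mul_of_nonneg_left (h x hx) hc
  smul_le_smul_of_nonneg_right f hf c d h x hx := by
    simpa using mul_le_mul_of_nonneg_right h (hf x hx)

/-- The value `sup {f y : 0 ≤ y ≤ x}` of the positive part of `f` at `x ≥ 0`. -/
def posVal (f : OrdDual E) (x : E) : ℝ := sSup (f '' Set.Icc 0 x)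

theorem bddAbove (f : OrdDual E) (x : E) : BddAbove (f '' Set.Icc 0 x) := by
  obtain ⟨C, hC⟩ := f.bounded 0 x
  refine ⟨C, ?_⟩
  rintro _ ⟨y, hy, rfl⟩
  exact (le_abs_self _).trans (hC y hy)

theorem le_posVal (f : OrdDual E) {x y : E} (hy : 0 ≤ y) (hyx : y ≤ x) : f y ≤ posVal f x :=
  le_csSup (f.bddAbove x) ⟨y, ⟨hy, hyx⟩, rfl⟩

theorem posVal_le (f : OrdDual E) {x : E} (hx : 0 ≤ x) {C : ℝ}
    (h : ∀ y, 0 ≤ y → y ≤ x → f y ≤ C) : posVal f x ≤ C := by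
  refine csSup_le ⟨_, 0, ⟨le_rfl, hx⟩, rfl⟩ ?_
  rintro _ ⟨y, hy, rfl⟩
  exact h y hy.1 hy.2

theorem posVal_nonneg (f : OrdDual E) {x : E} (hx : 0 ≤ x) : 0 ≤ posVal f x := by
  simpa using f.le_posVal le_rfl hx

theorem posVal_add (f : OrdDual E) {x y : E} (hx : 0 ≤ x) (hy : 0 ≤ y) :
    posVal f (x + y) = posVal f x + posVal f y := by
  apply le_antisymm
  · refine f.posVal_le (add_nonneg hx hy) fun z hz hzxy => ?_
    have h1 : f (z ⊓ x) ≤ posVal f x := f.le_posVal (le_inf hz hx) inf_le_right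
    have h2 : f (z - z ⊓ x) ≤ posVal f y := by
      refine f.le_posVal (sub_nonneg.2 inf_le_left) ?_
      rw [sub_le_iff_le_add, add_comm, ← sub_le_iff_le_add]
      exact le_inf (sub_le_self _ hy) (sub_le_iff_le_add.2 hzxy)
    rw [map_sub] at h2
    linarith
  · have key : ∀ z, 0 ≤ z → z ≤ x → posVal f y ≤ posVal f (x + y) - f z := by
      intro z hz hzx
      refine f.posVal_le hy fun t ht hty => ?_
      have := f.le_posVal (add_nonneg hz ht) (add_le_add hzx hty)
      rw [map_add] at this
      linarith
    have : posVal f x ≤ posVal f (x + y) - posVal f y :=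
      f.posVal_le hx fun z hz hzx => by linarith [key z hz hzx]
    linarith

theorem posVal_smul (f : OrdDual E) {c : ℝ} (hc : 0 ≤ c) {x : E} (hx : 0 ≤ x) :
    posVal f (c • x) = c * posVal f x := by
  have main : ∀ {c : ℝ}, 0 < c → ∀ {x : E}, 0 ≤ x → posVal f (c • x) ≤ c * posVal f x := by
    intro c hc x hx
    refine f.posVal_le (smul_nonneg hc.le hx) fun z hz hzx => ?_
    have h1 : f (c⁻¹ • z) ≤ posVal f x := by
      refine f.le_posVal (smul_nonneg (inv_nonneg.2 hc.le) hz) ?_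
      have := smul_le_smul_of_nonneg_left hzx (inv_nonneg.2 hc.le)
      rwa [smul_smul, inv_mul_cancel₀ hc.ne', one_smul] at this
    rw [map_smul, smul_eq_mul, inv_mul_le_iff₀ hc] at h1
    exact h1
  rcases hc.eq_or_lt with rfl | hc
  · have h0 := f.posVal_add (le_refl (0 : E)) le_rfl
    rw [add_zero] at h0
    rw [zero_smul, zero_mul]
    linarith
  · apply le_antisymm (main hc hx)
    have := main (inv_pos.2 hc) (smul_nonneg hc.le hx)
    rw [smul_smul, inv_mul_cancel₀ hc.ne', one_smul, le_inv_mul_iff₀ hc] at this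
    exact this

theorem posVal_sub (f : OrdDual E) {a b c d : E} (ha : 0 ≤ a) (hb : 0 ≤ b) (hc : 0 ≤ c)
    (hd : 0 ≤ d) (h : a - b = c - d) :
    posVal f a - posVal f b = posVal f c - posVal f d := by
  have h1 : a + d = c + b := by
    rw [sub_eq_sub_iff_add_eq_add] at h
    exact h
  have h2 := congrArg (posVal f) h1
  rw [posVal_add f ha hd, posVal_add f hc hb] at h2
  linarith

/-- The positive part of `f`, as a linear functional. -/
def posLin (f : OrdDual E) : E →ₗ[ℝ] ℝ where
  toFun x := posVal f x⁺ - posVal f x⁻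
  map_add' x y := by
    have h := f.posVal_sub (posPart_nonneg (x + y)) (negPart_nonneg (x + y))
      (add_nonneg (posPart_nonneg x) (posPart_nonneg y))
      (add_nonneg (negPart_nonneg x) (negPart_nonneg y)) (by
        rw [posPart_sub_negPart, add_sub_add_comm, posPart_sub_negPart, posPart_sub_negPart])
    rw [h, posVal_add f (posPart_nonneg x) (posPart_nonneg y),
      posVal_add f (negPart_nonneg x) (negPart_nonneg y)]
    ring
  map_smul' c x := by
    rw [RingHom.id_apply, smul_eq_mul]
    rcases le_total 0 c with hc | hc
    · have h := f.posVal_sub (posPart_nonneg (c • x)) (negPart_nonneg (c • x))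
        (smul_nonneg hc (posPart_nonneg x)) (smul_nonneg hc (negPart_nonneg x)) (by
          rw [posPart_sub_negPart, ← smul_sub, posPart_sub_negPart])
      rw [h, posVal_smul f hc (posPart_nonneg x), posVal_smul f hc (negPart_nonneg x)]
      ring
    · have hc' : 0 ≤ -c := neg_nonneg.2 hc
      have h := f.posVal_sub (posPart_nonneg (c • x)) (negPart_nonneg (c • x))
        (smul_nonneg hc' (negPart_nonneg x)) (smul_nonneg hc' (posPart_nonneg x)) (by
          rw [posPart_sub_negPart, ← smul_sub, neg_smul, ← smul_neg, neg_sub,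
            posPart_sub_negPart])
      rw [h, posVal_smul f hc' (posPart_nonneg x), posVal_smul f hc' (negPart_nonneg x)]
      ring

theorem posLin_apply (f : OrdDual E) {x : E} (hx : 0 ≤ x) : posLin f x = posVal f x := by
  have := f.posVal_sub (posPart_nonneg x) (negPart_nonneg x) hx le_rfl (by simp)
  have h0 := f.posVal_add (le_refl (0 : E)) le_rfl
  rw [add_zero] at h0
  change posVal f x⁺ - posVal f x⁻ = _
  linarith

/-- A linear functional which is nonnegative on the positive cone is order bounded. -/
theorem bounded_of_nonneg {f : E →ₗ[ℝ] ℝ} (hf : ∀ x, 0 ≤ x → 0 ≤ f x) (a b : E) :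
    ∃ C : ℝ, ∀ x ∈ Set.Icc a b, |f x| ≤ C := by
  refine ⟨|f a| + |f b|, fun x hx => ?_⟩
  have h1 := hf (x - a) (sub_nonneg.2 hx.1)
  have h2 := hf (b - x) (sub_nonneg.2 hx.2)
  rw [map_sub] at h1 h2
  rw [abs_le]
  constructor
  · linarith [neg_abs_le (f a), abs_nonneg (f b)]
  · linarith [le_abs_self (f b), abs_nonneg (f a)]

/-- The positive part of `f`. -/
def pos (f : OrdDual E) : OrdDual E :=
  mk (posLin f) (bounded_of_nonneg fun x hx => by
    rw [posLin_apply f hx]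
    exact f.posVal_nonneg hx)

theorem pos_apply (f : OrdDual E) {x : E} (hx : 0 ≤ x) :
    pos f x = sSup (f '' Set.Icc 0 x) := posLin_apply f hx

theorem pos_nonneg (f : OrdDual E) : 0 ≤ pos f := fun x hx => by
  rw [pos_apply f hx]
  exact f.posVal_nonneg hx

theorem le_pos (f : OrdDual E) : f ≤ pos f := fun x hx => by
  rw [pos_apply f hx]
  exact f.le_posVal hx le_rfl

theorem pos_le {f g : OrdDual E} (hg : 0 ≤ g) (h : f ≤ g) : pos f ≤ g := fun x hx => by
  rw [pos_apply f hx]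
  exact f.posVal_le hx fun y hy hyx => (h y hy).trans (mono hg hyx)

/-- The order dual of a Riesz space is a Riesz space. -/
instance : Lattice (OrdDual E) where
  sup f g := pos (f - g) + g
  inf f g := f - pos (f - g)
  le_sup_left f g := by
    have := le_pos (f - g)
    exact sub_le_iff_le_add.1 this
  le_sup_right f g := le_add_of_nonneg_left (pos_nonneg _)
  sup_le f g h hf hg := by
    have := pos_le (f := f - g) (g := h - g) (sub_nonneg.2 hg) (sub_le_sub_right hf g)
    exact le_sub_iff_add_le.1 this
  inf_le_left f g := sub_le_self _ (pos_nonneg _)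
  inf_le_right f g := by
    have := le_pos (f - g)
    exact sub_le_comm.1 this
  le_inf f g h hg hh := by
    have := pos_le (f := g - h) (g := g - f) (sub_nonneg.2 hg) (sub_le_sub_left hh g)
    exact le_sub_comm.1 this

end OrdDual

end Dual

/-! ### Regular multilinear operators -/

section Regular

variable {ι : Type w} (E : ι → Type u) [∀ i, AddCommGroup (E i)] [∀ i, Lattice (E i)]
  [∀ i, IsOrderedAddMonoid (E i)] [∀ i, Module ℝ (E i)] [∀ i, IsOrderedModule ℝ (E i)]
  (F : Type v) [AddCommGroup F] [Lattice F] [IsOrderedAddMonoid F] [Module ℝ F]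
  [IsOrderedModule ℝ F]

variable {E F} in
/-- A multilinear operator is positive if it maps tuples of positive vectors to positive
vectors. -/
def IsPositive (A : MultilinearMap ℝ E F) : Prop := ∀ x : ∀ i, E i, (∀ i, 0 ≤ x i) → 0 ≤ A x

variable {E F} in
theorem IsPositive.add {A B : MultilinearMap ℝ E F} (hA : IsPositive A) (hB : IsPositive B) :
    IsPositive (A + B) := fun x hx => add_nonneg (hA x hx) (hB x hx)

/-- The space `𝓛ᵣ(E₁, …, Eₘ; F)` of regular multilinear operators: the differences of two positive
multilinear operators. -/
def RegularMultilinear : Submodule ℝ (MultilinearMap ℝ E F) where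
  carrier := {A | ∃ A₁ A₂ : MultilinearMap ℝ E F, IsPositive A₁ ∧ IsPositive A₂ ∧ A = A₁ - A₂}
  zero_mem' := ⟨0, 0, fun _ _ => le_rfl, fun _ _ => le_rfl, (sub_zero _).symm⟩
  add_mem' := by
    rintro _ _ ⟨A₁, A₂, hA₁, hA₂, rfl⟩ ⟨B₁, B₂, hB₁, hB₂, rfl⟩
    exact ⟨A₁ + B₁, A₂ + B₂, hA₁.add hB₁, hA₂.add hB₂, sub_add_sub_comm _ _ _ _⟩
  smul_mem' := by
    rintro c _ ⟨A₁, A₂, hA₁, hA₂, rfl⟩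
    rcases le_total 0 c with hc | hc
    · exact ⟨c • A₁, c • A₂, fun x hx => smul_nonneg hc (hA₁ x hx),
        fun x hx => smul_nonneg hc (hA₂ x hx), smul_sub _ _ _⟩
    · have hc' : 0 ≤ -c := neg_nonneg.2 hc
      exact ⟨(-c) • A₂, (-c) • A₁, fun x hx => smul_nonneg hc' (hA₂ x hx),
        fun x hx => smul_nonneg hc' (hA₁ x hx), by
          rw [← smul_sub, neg_smul, ← smul_neg, neg_sub]⟩

end Regular

/-! ### Arens extensions -/

section Forms

variable {n : ℕ}

/-- A positive multilinear form satisfies `|B x| ≤ B |x|`. -/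
theorem IsPositive.abs_le : ∀ {n : ℕ} {G : Fin n → Type u} [∀ i, AddCommGroup (G i)]
    [∀ i, Lattice (G i)] [∀ i, IsOrderedAddMonoid (G i)] [∀ i, Module ℝ (G i)]
    [∀ i, IsOrderedModule ℝ (G i)] {B : MultilinearMap ℝ G ℝ}, IsPositive B →
    ∀ x : ∀ i, G i, |B x| ≤ B (fun i => |x i|) := by
  intro n
  induction n with
  | zero =>
    intro G _ _ _ _ _ B hB x
    have h : x = fun i => |x i| := Subsingleton.elim _ _
    have h0 : 0 ≤ B x := hB x fun i => i.elim0
    rw [abs_of_nonneg h0, ← h]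
  | succ n ih =>
    intro G _ _ _ _ _ B hB x
    have hpos : ∀ t : G 0, 0 ≤ t → IsPositive (B.curryLeft t) := by
      intro t ht y hy
      refine hB _ fun i => ?_
      cases i using Fin.cases with
      | zero => exact ht
      | succ i => exact hy i
    have e : ∀ y : ∀ i, G i, B y = B.curryLeft (y 0) (Fin.tail y) := by
      intro y
      rw [MultilinearMap.curryLeft_apply, Fin.cons_self_tail]
    rw [e x, e fun i => |x i|]
    have h1 := ih (hpos _ (posPart_nonneg (x 0))) (Fin.tail x)
    have h2 := ih (hpos _ (negPart_nonneg (x 0))) (Fin.tail x)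
    have e1 : B.curryLeft (x 0) = B.curryLeft (x 0)⁺ - B.curryLeft (x 0)⁻ := by
      rw [← map_sub, posPart_sub_negPart]
    have e2 : B.curryLeft |x 0| = B.curryLeft (x 0)⁺ + B.curryLeft (x 0)⁻ := by
      rw [← map_add, posPart_add_negPart]
    rw [e1, e2, sub_apply, add_apply]
    exact (abs_sub _ _).trans (add_le_add h1 h2)

section Step

variable {G : Fin (n + 1) → Type u} [∀ i, AddCommGroup (G i)] [∀ i, Lattice (G i)]
  [∀ i, IsOrderedAddMonoid (G i)] [∀ i, Module ℝ (G i)] [∀ i, IsOrderedModule ℝ (G i)]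

/-- The linear functional `t ↦ B (t, x₂, …)` on the first space. -/
def firstVarLin (B : MultilinearMap ℝ G ℝ) (x : ∀ i : Fin n, G i.succ) : G 0 →ₗ[ℝ] ℝ where
  toFun t := B (Fin.cons t x)
  map_add' s t := B.cons_add x s t
  map_smul' c t := B.cons_smul x c t

theorem firstVarLin_bounded_of_pos {B : MultilinearMap ℝ G ℝ} (hB : IsPositive B)
    (x : ∀ i : Fin n, G i.succ) (a b : G 0) :
    ∃ C : ℝ, ∀ t ∈ Set.Icc a b, |firstVarLin B x t| ≤ C := by
  obtain ⟨C, hC⟩ := OrdDual.bounded_of_nonneg (f := firstVarLin B fun i => |x i|)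
    (fun t ht => hB _ fun i => by
      cases i using Fin.cases with
      | zero => exact ht
      | succ i => exact abs_nonneg (x i)) 0 (|a| + |b|)
  refine ⟨C, fun t ht => (hB.abs_le _).trans ?_⟩
  have h := hC |t| ⟨abs_nonneg t, ?_⟩
  · refine le_trans (le_of_eq ?_) ((le_abs_self _).trans h)
    refine congrArg B ?_
    ext i
    cases i using Fin.cases <;> rfl
  · refine abs_le'.2 ⟨?_, ?_⟩
    · exact ht.2.trans ((le_abs_self b).trans (le_add_of_nonneg_left (abs_nonneg a)))
    · exact (neg_le_neg ht.1).trans ((neg_le_abs a).trans (le_add_of_nonneg_right (abs_nonneg b)))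

/-- For a regular form `B`, the functional `B(•, x₂, …)` in the order dual of the first space. -/
def firstVar (B : RegularMultilinear G ℝ) (x : ∀ i : Fin n, G i.succ) : OrdDual (G 0) :=
  OrdDual.mk (firstVarLin B.1 x) (by
    obtain ⟨B, B₁, B₂, h₁, h₂, rfl⟩ := B
    intro a b
    obtain ⟨C, hC⟩ := firstVarLin_bounded_of_pos h₁ x a b
    obtain ⟨D, hD⟩ := firstVarLin_bounded_of_pos h₂ x a b
    exact ⟨C + D, fun t ht => (abs_sub _ _).trans (add_le_add (hC t ht) (hD t ht))⟩)

@[simp] theorem firstVar_apply (B : RegularMultilinear G ℝ) (x : ∀ i : Fin n, G i.succ) (t : G 0) :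
    firstVar B x t = B.1 (Fin.cons t x) := rfl

/-- The multilinear form `(x₂, …) ↦ x''(B(•, x₂, …))` in the remaining variables. -/
def arensStepAux (x'' : OrdDual (OrdDual (G 0))) (B : RegularMultilinear G ℝ) :
    MultilinearMap ℝ (fun i : Fin n => G i.succ) ℝ :=
  MultilinearMap.mk' (fun x => x'' (firstVar B x))
    (fun x i s t => by
      rw [← map_add]
      refine congrArg x'' (OrdDual.ext fun r => ?_)
      exact (B.1.curryLeft r).map_update_add x i s t)
    (fun x i c t => by
      rw [← map_smul]
      refine congrArg x'' (OrdDual.ext fun r => ?_)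
      exact (B.1.curryLeft r).map_update_smul x i c t)

@[simp] theorem arensStepAux_apply (x'' : OrdDual (OrdDual (G 0))) (B : RegularMultilinear G ℝ)
    (x : ∀ i : Fin n, G i.succ) : arensStepAux x'' B x = x'' (firstVar B x) := rfl

theorem regular_of_pos {ι : Type w} {E : ι → Type u} [∀ i, AddCommGroup (E i)]
    [∀ i, Lattice (E i)] [∀ i, IsOrderedAddMonoid (E i)] [∀ i, Module ℝ (E i)]
    [∀ i, IsOrderedModule ℝ (E i)] {F : Type v} [AddCommGroup F] [Lattice F]
    [IsOrderedAddMonoid F] [Module ℝ F] [IsOrderedModule ℝ F] {B : MultilinearMap ℝ E F}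
    (hB : IsPositive B) : B ∈ RegularMultilinear E F :=
  ⟨B, 0, hB, fun _ _ => le_rfl, (sub_zero B).symm⟩

theorem arensStepAux_pos {x'' : OrdDual (OrdDual (G 0))} (hx : 0 ≤ x'')
    {B : RegularMultilinear G ℝ} (hB : IsPositive B.1) : IsPositive (arensStepAux x'' B) :=
  fun x h => hx (firstVar B x) fun t ht => hB _ fun i => by
    cases i using Fin.cases with
    | zero => exact ht
    | succ i => exact h i

/-- The operator `B ↦ x''(B(•, x₂, …))` from regular forms in the variables `x₁, x₂, …` to regular
forms in the variables `x₂, …`, for `x''` in the second order dual of the first space. -/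
def arensStep : OrdDual (OrdDual (G 0)) →ₗ[ℝ] RegularMultilinear G ℝ →ₗ[ℝ]
    RegularMultilinear (fun i : Fin n => G i.succ) ℝ :=
  LinearMap.mk₂ ℝ
    (fun x'' B => ⟨arensStepAux x'' B, by
      obtain ⟨B, B₁, B₂, h₁, h₂, rfl⟩ := B
      have key : ∀ B : MultilinearMap ℝ G ℝ, ∀ hB : IsPositive B,
          arensStepAux x'' ⟨B, regular_of_pos hB⟩ ∈
            RegularMultilinear (fun i : Fin n => G i.succ) ℝ := by
        intro B hB
        refine ⟨arensStepAux x''⁺ ⟨B, regular_of_pos hB⟩, arensStepAux x''⁻ ⟨B, regular_of_pos hB⟩,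
          arensStepAux_pos (posPart_nonneg x'') hB, arensStepAux_pos (negPart_nonneg x'') hB, ?_⟩
        ext x
        rw [sub_apply, arensStepAux_apply, arensStepAux_apply, arensStepAux_apply,
          ← OrdDual.sub_apply, posPart_sub_negPart]
      have h := Submodule.sub_mem _ (key B₁ h₁) (key B₂ h₂)
      convert h using 1
      ext x
      rw [sub_apply, arensStepAux_apply, arensStepAux_apply, arensStepAux_apply,
        ← map_sub]
      rfl⟩)
    (fun _ _ _ => rfl)
    (fun _ _ _ => rfl)
    (fun x'' B C => Subtype.ext (MultilinearMap.ext fun x =>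
      map_add x'' (firstVar B x) (firstVar C x)))
    (fun c x'' B => Subtype.ext (MultilinearMap.ext fun x => map_smul x'' c (firstVar B x)))

theorem arensStep_apply (x'' : OrdDual (OrdDual (G 0))) (B : RegularMultilinear G ℝ)
    (x : ∀ i : Fin n, G i.succ) : (arensStep x'' B).1 x = x'' (firstVar B x) := rfl

end Step

/-- The value at `(x₁'', …, xₙ'')` of the extension of a regular form `B`, obtained by applying
`x₁''` in the first variable, then `x₂''` in the second variable of the resulting form, and so on.
It is linear in `B` and multilinear in `(x₁'', …, xₙ'')`. -/
def arensForm : ∀ (n : ℕ) (G : Fin n → Type u) [∀ i, AddCommGroup (G i)] [∀ i, Lattice (G i)]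
    [∀ i, IsOrderedAddMonoid (G i)] [∀ i, Module ℝ (G i)] [∀ i, IsOrderedModule ℝ (G i)],
    RegularMultilinear G ℝ →ₗ[ℝ] MultilinearMap ℝ (fun i => OrdDual (OrdDual (G i))) ℝ
  | 0, _, _, _, _, _, _ =>
    { toFun := fun B => MultilinearMap.constOfIsEmpty ℝ _ (B.1 0)
      map_add' := fun _ _ => rfl
      map_smul' := fun _ _ => rfl }
  | n + 1, G, _, _, _, _, _ =>
    { toFun := fun B => LinearMap.uncurryLeft
        ((arensForm n fun i => G i.succ) ∘ₗ arensStep.flip B)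
      map_add' := fun B C => by
        ext x''
        simp
      map_smul' := fun c B => by
        ext x''
        simp }

theorem arensForm_zero {G : Fin 0 → Type u} [∀ i, AddCommGroup (G i)] [∀ i, Lattice (G i)]
    [∀ i, IsOrderedAddMonoid (G i)] [∀ i, Module ℝ (G i)] [∀ i, IsOrderedModule ℝ (G i)]
    (B : RegularMultilinear G ℝ) (x'' : ∀ i, OrdDual (OrdDual (G i))) :
    arensForm 0 G B x'' = B.1 0 := rfl

theorem arensForm_succ {G : Fin (n + 1) → Type u} [∀ i, AddCommGroup (G i)]
    [∀ i, Lattice (G i)] [∀ i, IsOrderedAddMonoid (G i)] [∀ i, Module ℝ (G i)]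
    [∀ i, IsOrderedModule ℝ (G i)] (B : RegularMultilinear G ℝ)
    (x'' : ∀ i, OrdDual (OrdDual (G i))) :
    arensForm (n + 1) G B x'' =
      arensForm n (fun i => G i.succ) (arensStep (x'' 0) B) (fun i => x'' i.succ) := rfl

theorem arensForm_pos : ∀ (n : ℕ) (G : Fin n → Type u) [∀ i, AddCommGroup (G i)]
    [∀ i, Lattice (G i)] [∀ i, IsOrderedAddMonoid (G i)] [∀ i, Module ℝ (G i)]
    [∀ i, IsOrderedModule ℝ (G i)] (B : RegularMultilinear G ℝ), IsPositive B.1 →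
    IsPositive (arensForm n G B) := by
  intro n
  induction n with
  | zero =>
    intro G _ _ _ _ _ B hB x'' _
    exact hB 0 fun i => i.elim0
  | succ n ih =>
    intro G _ _ _ _ _ B hB x'' hx
    rw [arensForm_succ]
    exact ih _ _ (arensStepAux_pos (hx 0) hB) _ fun i => hx i.succ

end Forms

section Arens

variable {m : ℕ} {E : Fin m → Type u} [∀ i, AddCommGroup (E i)] [∀ i, Lattice (E i)]
  [∀ i, IsOrderedAddMonoid (E i)] [∀ i, Module ℝ (E i)] [∀ i, IsOrderedModule ℝ (E i)]
  {F : Type v} [AddCommGroup F] [Lattice F] [IsOrderedAddMonoid F] [Module ℝ F]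
  [IsOrderedModule ℝ F]

/-- The form `y' ∘ A` with its variables listed in the order `x_{ρ(1)}, …, x_{ρ(m)}`. -/
def permutedForm (ρ : Equiv.Perm (Fin m)) (A : MultilinearMap ℝ E F) (y' : OrdDual F) :
    MultilinearMap ℝ (fun k => E (ρ k)) ℝ :=
  MultilinearMap.domDomCongrLinearEquiv' ℝ ℝ E ℝ ρ.symm
    ((OrdDual.toLin y').compMultilinearMap A)

/-- The characterizing property of `permutedForm`. -/
theorem permutedForm_apply (ρ : Equiv.Perm (Fin m)) (A : MultilinearMap ℝ E F) (y' : OrdDual F)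
    (x : ∀ i, E i) : permutedForm ρ A y' (fun k => x (ρ k)) = y' (A x) := by
  change y' (A ((ρ.symm.piCongrLeft' E).symm (ρ.symm.piCongrLeft' E x))) = _
  rw [Equiv.symm_apply_apply]

theorem permutedForm_apply' (ρ : Equiv.Perm (Fin m)) (A : MultilinearMap ℝ E F) (y' : OrdDual F)
    (x : ∀ k, E (ρ k)) :
    permutedForm ρ A y' x = y' (A ((ρ.symm.piCongrLeft' E).symm x)) := rfl

theorem permutedForm_pos (ρ : Equiv.Perm (Fin m)) {A : MultilinearMap ℝ E F} (hA : IsPositive A)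
    {y' : OrdDual F} (hy : 0 ≤ y') : IsPositive (permutedForm ρ A y') := by
  intro x hx
  rw [permutedForm_apply']
  refine hy _ (hA _ fun i => ?_)
  obtain ⟨k, rfl⟩ := ρ.surjective i
  have h : (ρ.symm.piCongrLeft' E).symm x (ρ k) = x k := by
    have := congrFun ((ρ.symm.piCongrLeft' E).apply_symm_apply x) k
    exact this
  rw [h]
  exact hx k

theorem permutedForm_regular (ρ : Equiv.Perm (Fin m)) (A : RegularMultilinear E F)
    (y' : OrdDual F) :
    permutedForm ρ A.1 y' ∈ RegularMultilinear (fun k => E (ρ k)) ℝ := by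
  obtain ⟨A, A₁, A₂, h₁, h₂, rfl⟩ := A
  refine ⟨permutedForm ρ A₁ y'⁺ + permutedForm ρ A₂ y'⁻,
    permutedForm ρ A₁ y'⁻ + permutedForm ρ A₂ y'⁺,
    (permutedForm_pos ρ h₁ (posPart_nonneg y')).add (permutedForm_pos ρ h₂ (negPart_nonneg y')),
    (permutedForm_pos ρ h₁ (negPart_nonneg y')).add (permutedForm_pos ρ h₂ (posPart_nonneg y')),
    ?_⟩
  ext x
  simp only [permutedForm_apply', sub_apply, add_apply, map_sub]
  conv_lhs => rw [← posPart_sub_negPart y']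
  simp only [OrdDual.sub_apply]
  ring

/-- The linear operator `y' ↦ y' ∘ A` (with permuted variables) from the order dual of `F` to
regular forms. -/
def composeForm (ρ : Equiv.Perm (Fin m)) (A : RegularMultilinear E F) :
    OrdDual F →ₗ[ℝ] RegularMultilinear (fun k => E (ρ k)) ℝ where
  toFun y' := ⟨permutedForm ρ A.1 y', permutedForm_regular ρ A y'⟩
  map_add' _ _ := rfl
  map_smul' _ _ := rfl

/-- The linear functional `y' ↦ (x_{ρ(m)}'' ∘ ⋯ ∘ x_{ρ(1)}'')(y' ∘ A)` on the order dual of `F`. -/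
def arensLin (ρ : Equiv.Perm (Fin m)) (A : RegularMultilinear E F)
    (x'' : ∀ i, OrdDual (OrdDual (E i))) : OrdDual F →ₗ[ℝ] ℝ where
  toFun y' := arensForm m (fun k => E (ρ k)) (composeForm ρ A y') (fun k => x'' (ρ k))
  map_add' y z := by simp
  map_smul' c y := by simp

theorem arensLin_bounded_of_pos (ρ : Equiv.Perm (Fin m)) {A : RegularMultilinear E F}
    (hA : IsPositive A.1) (x'' : ∀ i, OrdDual (OrdDual (E i))) (a b : OrdDual F) :
    ∃ C : ℝ, ∀ y ∈ Set.Icc a b, |arensLin ρ A x'' y| ≤ C := by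
  have hpos : ∀ y : OrdDual F, 0 ≤ y →
      IsPositive (arensForm m (fun k => E (ρ k)) (composeForm ρ A y)) :=
    fun y hy => arensForm_pos m _ _ (permutedForm_pos ρ hA hy)
  have habs : ∀ y : OrdDual F, 0 ≤ y →
      |arensLin ρ A x'' y| ≤ arensLin ρ A (fun i => |x'' i|) y :=
    fun y hy => (hpos y hy).abs_le _
  have hnn : ∀ y : OrdDual F, 0 ≤ y → 0 ≤ arensLin ρ A (fun i => |x'' i|) y :=
    fun y hy => hpos y hy _ fun k => abs_nonneg _
  refine ⟨arensLin ρ A (fun i => |x'' i|) (b - a) + |arensLin ρ A x'' a|, fun y hy => ?_⟩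
  have h1 := habs (y - a) (sub_nonneg.2 hy.1)
  have h2 := hnn (b - y) (sub_nonneg.2 hy.2)
  rw [map_sub] at h1 h2 ⊢
  rw [map_sub] at h1
  have h3 := abs_sub_abs_le_abs_sub (arensLin ρ A x'' y) (arensLin ρ A x'' a)
  linarith

theorem arensLin_sub (ρ : Equiv.Perm (Fin m)) (A B : RegularMultilinear E F)
    (x'' : ∀ i, OrdDual (OrdDual (E i))) (y' : OrdDual F) :
    arensLin ρ (A - B) x'' y' = arensLin ρ A x'' y' - arensLin ρ B x'' y' := by
  have h : composeForm ρ (A - B) y' = composeForm ρ A y' - composeForm ρ B y' :=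
    Subtype.ext (MultilinearMap.ext fun x => map_sub y' _ _)
  change arensForm m _ (composeForm ρ (A - B) y') _ = _
  have h2 := LinearMap.map_sub (arensForm m fun k => E (ρ k)) (composeForm ρ A y')
    (composeForm ρ B y')
  rw [h, h2]
  rfl

/-- The functional `arensLin ρ A x''`, as an element of the second order dual of `F`. -/
def arensValue (ρ : Equiv.Perm (Fin m)) (A : RegularMultilinear E F)
    (x'' : ∀ i, OrdDual (OrdDual (E i))) : OrdDual (OrdDual F) :=
  OrdDual.mk (arensLin ρ A x'') (by
    obtain ⟨A, A₁, A₂, h₁, h₂, rfl⟩ := A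
    intro a b
    obtain ⟨C, hC⟩ := arensLin_bounded_of_pos ρ (A := ⟨A₁, regular_of_pos h₁⟩) h₁ x'' a b
    obtain ⟨D, hD⟩ := arensLin_bounded_of_pos ρ (A := ⟨A₂, regular_of_pos h₂⟩) h₂ x'' a b
    refine ⟨C + D, fun y hy => ?_⟩
    refine le_trans (le_of_eq ?_) ((abs_sub _ _).trans (add_le_add (hC y hy) (hD y hy)))
    exact congrArg _ (arensLin_sub ρ ⟨A₁, regular_of_pos h₁⟩ ⟨A₂, regular_of_pos h₂⟩ x'' y))

theorem arensValue_apply (ρ : Equiv.Perm (Fin m)) (A : RegularMultilinear E F)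
    (x'' : ∀ i, OrdDual (OrdDual (E i))) (y' : OrdDual F) :
    arensValue ρ A x'' y' =
      arensForm m (fun k => E (ρ k)) (composeForm ρ A y') (fun k => x'' (ρ k)) := rfl

/-- `arensValue` as a multilinear operator. -/
def arensMultilinear (ρ : Equiv.Perm (Fin m)) (A : RegularMultilinear E F) :
    MultilinearMap ℝ (fun i => OrdDual (OrdDual (E i))) (OrdDual (OrdDual F)) :=
  MultilinearMap.mk' (arensValue ρ A)
    (fun x'' i s t => by
      obtain ⟨k, rfl⟩ := ρ.surjective i
      ext y'
      rw [OrdDual.add_apply]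
      simp only [arensValue_apply]
      have h := fun r => Function.update_comp_eq_of_injective' x'' ρ.injective k r
      rw [h, h, h, MultilinearMap.map_update_add])
    (fun x'' i c t => by
      obtain ⟨k, rfl⟩ := ρ.surjective i
      ext y'
      rw [OrdDual.smul_apply]
      simp only [arensValue_apply]
      have h := fun r => Function.update_comp_eq_of_injective' x'' ρ.injective k r
      rw [h, h, MultilinearMap.map_update_smul, smul_eq_mul])

theorem arensMultilinear_pos (ρ : Equiv.Perm (Fin m)) {A : RegularMultilinear E F}
    (hA : IsPositive A.1) : IsPositive (arensMultilinear ρ A) :=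
  fun _ hx _ hy => arensForm_pos m _ _ (permutedForm_pos ρ hA hy) _ fun k => hx (ρ k)

/-- The Arens extension `AR_m^ρ(A)` of a regular multilinear operator `A` with respect to the
permutation `ρ`. -/
def arensExtension (ρ : Equiv.Perm (Fin m)) (A : RegularMultilinear E F) :
    RegularMultilinear (fun i => OrdDual (OrdDual (E i))) (OrdDual (OrdDual F)) :=
  ⟨arensMultilinear ρ A, by
    obtain ⟨A, A₁, A₂, h₁, h₂, rfl⟩ := A
    refine ⟨arensMultilinear ρ ⟨A₁, regular_of_pos h₁⟩,
      arensMultilinear ρ ⟨A₂, regular_of_pos h₂⟩, arensMultilinear_pos ρ h₁,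
      arensMultilinear_pos ρ h₂, ?_⟩
    ext x'' y'
    exact arensLin_sub ρ ⟨A₁, regular_of_pos h₁⟩ ⟨A₂, regular_of_pos h₂⟩ x'' y'⟩

/-- The defining formula of the Arens extension. -/
theorem arensExtension_apply (ρ : Equiv.Perm (Fin m)) (A : RegularMultilinear E F)
    (x'' : ∀ i, OrdDual (OrdDual (E i))) (y' : OrdDual F) :
    (arensExtension ρ A).1 x'' y' =
      arensForm m (fun k => E (ρ k)) (composeForm ρ A y') (fun k => x'' (ρ k)) := rfl

end Arens

/-! ### Operators of finite type and separate order continuity -/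

section Notions

variable {ι : Type w} {E : ι → Type u} [∀ i, AddCommGroup (E i)] [∀ i, Lattice (E i)]
  [∀ i, IsOrderedAddMonoid (E i)] [∀ i, Module ℝ (E i)] [∀ i, IsOrderedModule ℝ (E i)]
  {F : Type v} [AddCommGroup F] [Lattice F] [IsOrderedAddMonoid F] [Module ℝ F]
  [IsOrderedModule ℝ F]

/-- A regular multilinear operator is of finite type if it is of the form
`A(x₁, …, xₘ) = ∑ⱼ φⱼ¹(x₁) ⋯ φⱼᵐ(xₘ) yⱼ` with `φⱼⁱ` in the order dual of `Eᵢ` and `yⱼ ∈ F`. -/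
def IsFiniteType [Fintype ι] (A : RegularMultilinear E F) : Prop :=
  ∃ (n : ℕ) (φ : Fin n → ∀ i, OrdDual (E i)) (y : Fin n → F),
    ∀ x : ∀ i, E i, A.1 x = ∑ j, (∏ i, φ j i (x i)) • y j

end Notions

section OrderContinuity

/-- `y_α ↓ 0`: the net `y` is decreasing with infimum `0`. -/
def DecreasesToZero {Ω : Type w} [Preorder Ω] {X : Type u} [AddCommGroup X] [Lattice X]
    (y : Ω → X) : Prop :=
  Antitone y ∧ IsGLB (Set.range y) 0

/-- Order convergence of the net `x` to `l`. -/
def OrderConverges {Ω : Type w} [Preorder Ω] {X : Type u} [AddCommGroup X] [Lattice X]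
    (x : Ω → X) (l : X) : Prop :=
  ∃ y : Ω → X, DecreasesToZero y ∧ ∀ α, |x α - l| ≤ y α

/-- A linear operator is order continuous if it maps nets order convergent to zero (indexed by
arbitrary nonempty directed sets, of any given universe level) to nets order convergent to zero. -/
def IsOrderContinuous {X : Type u} [AddCommGroup X] [Lattice X] [Module ℝ X] {Y : Type v}
    [AddCommGroup Y] [Lattice Y] [Module ℝ Y] (T : X →ₗ[ℝ] Y) : Prop :=
  ∀ (Ω : Type w) [Preorder Ω] [IsDirectedOrder Ω] [Nonempty Ω] (x : Ω → X),
    OrderConverges x 0 → OrderConverges (fun α => T (x α)) 0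

/-- A multilinear operator is separately order continuous if, for each `j` and each choice of the
other variables, the linear operator `xⱼ ↦ A(x₁, …, xₘ)` is order continuous. -/
def IsSeparatelyOrderContinuous {m : ℕ} {X : Fin m → Type u} [∀ i, AddCommGroup (X i)]
    [∀ i, Lattice (X i)] [∀ i, Module ℝ (X i)] {Y : Type v} [AddCommGroup Y] [Lattice Y]
    [Module ℝ Y] (A : MultilinearMap ℝ X Y) : Prop :=
  ∀ (j : Fin m) (x : ∀ i, X i), IsOrderContinuous.{u, v, w} (A.toLinearMap x j)

end OrderContinuity

end Riesz

end

/-! Write `A` as `∑ j, φ_j¹ ⋯ φ_jᵐ • y_j`. Slicing `y' ∘ A` in one variable gives a finite linear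
combination of the functionals `φ_j` of that variable. Applying `x''` to this slice only replaces
each such functional by the number `x''(φ_j)`. After all variables are used up, every Arens
extension sends `x''` to `∑ j, (∏ i, x''_i(φ_jⁱ)) • ŷ_j`, where `ŷ_j` is evaluation at `y_j`. The
order of the variables affects only the order of the factors, so real multiplication being
commutative removes `ρ`. The induction is `arensForm_eq_sum`, and the resulting formula is
`arensExtension_eq_sum`.

The formula is of finite type, because `x''_i ↦ x''_i(φ_jⁱ)` is itself evaluation at `φ_jⁱ`. With
the other variables frozen, it is a finite sum of evaluations times fixed vectors. Such a map is
order continuous because a net decreasing to zero in an order dual tends to zero at every vector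
(`tendsto_apply_of_decreasesToZero`). Conversely, an antitone net of functionals tending to zero
pointwise on the cone decreases to zero. -/

namespace Riesz

open Filter Topology

/-! ### Evaluations and decreasing nets in an order dual -/

namespace OrdDual

variable {E : Type u} [AddCommGroup E] [Lattice E] [IsOrderedAddMonoid E] [Module ℝ E]
  [IsOrderedModule ℝ E]

theorem sum_apply {κ : Type*} (s : Finset κ) (f : κ → OrdDual E) (x : E) :
    (∑ j ∈ s, f j) x = ∑ j ∈ s, f j x := by
  simp only [← toLin_apply, map_sum, LinearMap.sum_apply]

/-- On the positive cone this is just `±f ≤ |f|`. The general case follows from `x = x⁺ - x⁻` and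
`|x| = x⁺ + x⁻`, so no explicit formula for `|f|` is needed. -/
theorem abs_apply_le (f : OrdDual E) (x : E) : |f x| ≤ |f| |x| := by
  have key : ∀ y : E, 0 ≤ y → |f y| ≤ |f| y := fun y hy =>
    abs_le'.2 ⟨le_abs_self f y hy, neg_le_abs f y hy⟩
  have h₁ := key _ (posPart_nonneg x)
  have h₂ := key _ (negPart_nonneg x)
  rw [← posPart_add_negPart x, map_add]
  conv_lhs => rw [← posPart_sub_negPart x, map_sub]
  exact (abs_sub _ _).trans (add_le_add h₁ h₂)

theorem abs_apply_le_of_abs_le {f g : OrdDual E} (h : |f| ≤ g) (x : E) : |f x| ≤ g |x| :=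
  (abs_apply_le f x).trans (h _ (abs_nonneg x))

/-- Evaluation at a vector, as a linear functional on the order dual. -/
def evalLin (x : E) : OrdDual E →ₗ[ℝ] ℝ where
  toFun f := f x
  map_add' _ _ := rfl
  map_smul' _ _ := rfl

/-- The canonical map of a Riesz space into its second order dual. -/
noncomputable def eval (x : E) : OrdDual (OrdDual E) :=
  mk (evalLin x) (by
    -- Evaluation at a positive vector is a positive functional, hence order bounded; a general
    -- evaluation is a difference of two of these.
    have key : ∀ y : E, 0 ≤ y → evalLin y ∈ orderBoundedFunctionals (OrdDual E) := fun y hy =>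
      bounded_of_nonneg fun f hf => hf y hy
    have h := Submodule.sub_mem _ (key _ (posPart_nonneg x)) (key _ (negPart_nonneg x))
    have e : evalLin x⁺ - evalLin x⁻ = evalLin x := LinearMap.ext fun f => by
      change f x⁺ - f x⁻ = f x
      rw [← map_sub, posPart_sub_negPart]
    exact e ▸ h)

@[simp] theorem eval_apply (x : E) (f : OrdDual E) : eval x f = f x := rfl

/-- A net decreasing to zero in an order dual converges to zero pointwise. -/
theorem tendsto_apply_of_decreasesToZero {Ω : Type w} [Preorder Ω] [IsDirectedOrder Ω]
    [Nonempty Ω] {f : Ω → OrdDual E} (hf : DecreasesToZero f) (x : E) :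
    Tendsto (fun α => f α x) atTop (𝓝 0) := by
  have hnn : ∀ α, 0 ≤ f α := fun α => hf.2.1 ⟨α, rfl⟩
  have hanti : ∀ y : E, 0 ≤ y → Antitone fun α => f α y := fun y hy _ _ h => hf.1 h y hy
  have hbdd : ∀ y : E, 0 ≤ y → BddBelow (Set.range fun α => f α y) := by
    rintro y hy
    refine ⟨0, ?_⟩
    rintro _ ⟨α, rfl⟩
    exact hnn α y hy
  -- At a positive vector the values form a decreasing real net bounded below by `0`, hence
  -- convergent; `y = y⁺ - y⁻` gives the rest.
  have hlim : ∀ y : E, ∃ l : ℝ, Tendsto (fun α => f α y) atTop (𝓝 l) := by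
    intro y
    have h := (tendsto_atTop_ciInf (hanti _ (posPart_nonneg y)) (hbdd _ (posPart_nonneg y))).sub
      (tendsto_atTop_ciInf (hanti _ (negPart_nonneg y)) (hbdd _ (negPart_nonneg y)))
    simp only [← map_sub, posPart_sub_negPart] at h
    exact ⟨_, h⟩
  choose l hl using hlim
  -- The pointwise limit is linear, and it is positive as a limit of positive functionals. It
  -- therefore belongs to the order dual and can be compared with the infimum.
  let L : E →ₗ[ℝ] ℝ := linearMapOfTendsto l (fun α => toLin (f α)) (tendsto_pi_nhds.2 hl)
  let g : OrdDual E := mk L (bounded_of_nonneg fun y hy =>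
    ge_of_tendsto' (hl y) fun α => hnn α y hy)
  -- The limit `g` lies below every `f α`, so it lies below their infimum `0`. Together with
  -- positivity this forces `g = 0`.
  have hg : g ≤ 0 := by
    refine hf.2.2 ?_
    rintro _ ⟨α, rfl⟩ y hy
    exact (hanti y hy).le_of_tendsto (hl y) α
  have hzero : ∀ y : E, 0 ≤ y → l y = 0 := fun y hy =>
    le_antisymm (hg y hy) (ge_of_tendsto' (hl y) fun α => hnn α y hy)
  have hgx : g = 0 := eq_of_nonneg hzero
  have h : l x = 0 := DFunLike.congr_fun hgx x
  exact h ▸ hl x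

/-- Antitone nets of positive functionals that converge to zero pointwise decrease to zero. -/
theorem decreasesToZero_of_tendsto {Ω : Type w} [Preorder Ω] [IsDirectedOrder Ω]
    [Nonempty Ω] {f : Ω → OrdDual E} (hf : Antitone f)
    (h : ∀ x, 0 ≤ x → Tendsto (fun α => f α x) atTop (𝓝 0)) : DecreasesToZero f := by
  refine ⟨hf, ?_, ?_⟩
  · rintro _ ⟨α, rfl⟩ x hx
    exact Antitone.le_of_tendsto (fun _ _ hab => hf hab x hx) (h x hx) α
  · intro g hg x hx
    exact ge_of_tendsto' (h x hx) fun α => hg ⟨α, rfl⟩ x hx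

end OrdDual

/-! ### Order continuity of finite sums of evaluations -/

/-- A linear operator into a second order dual which is a finite sum of evaluations
at elements of an order dual times fixed vectors is order continuous. -/
theorem isOrderContinuous_of_eq_sum {E : Type u} [AddCommGroup E] [Lattice E]
    [IsOrderedAddMonoid E] [Module ℝ E] [IsOrderedModule ℝ E] {F : Type v} [AddCommGroup F]
    [Lattice F] [IsOrderedAddMonoid F] [Module ℝ F] [IsOrderedModule ℝ F] {κ : Type*} [Fintype κ]
    (T : OrdDual E →ₗ[ℝ] OrdDual F) (x : κ → E) (y : κ → OrdDual F)
    (hT : ∀ f, T f = ∑ j, f (x j) • y j) : IsOrderContinuous.{u, v, w} T := by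
  intro Ω _ _ _ f hf
  obtain ⟨g, hg, hfg⟩ := hf
  simp only [sub_zero] at hfg
  -- The dominating net comes from the triangle inequality and `|f α (x j)| ≤ g α |x j|`. It
  -- decreases because `g` does and the vectors `|y j|` are positive.
  refine ⟨fun α => ∑ j, g α |x j| • |y j|, OrdDual.decreasesToZero_of_tendsto ?_ ?_, ?_⟩
  · intro α β hαβ
    exact Finset.sum_le_sum fun j _ => smul_le_smul_of_nonneg_right
      (hg.1 hαβ _ (abs_nonneg _)) (abs_nonneg _)
  · intro z _
    simp only [OrdDual.sum_apply, OrdDual.smul_apply]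
    have h := tendsto_finsetSum (Finset.univ : Finset κ) fun j _ =>
      (OrdDual.tendsto_apply_of_decreasesToZero hg |x j|).mul_const (|y j| z)
    simpa using h
  · intro α
    -- The order of the dual is tested on positive vectors only. A pointwise bound on `±T (f α)`
    -- there already bounds the modulus of `T (f α)`.
    have key : ∀ z : F, 0 ≤ z → |T (f α) z| ≤ (∑ j, g α |x j| • |y j|) z := by
      intro z hz
      rw [hT, OrdDual.sum_apply, OrdDual.sum_apply]
      refine (Finset.abs_sum_le_sum_abs _ _).trans (Finset.sum_le_sum fun j _ => ?_)
      rw [OrdDual.smul_apply, OrdDual.smul_apply, abs_mul]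
      have h := OrdDual.abs_apply_le (y j) z
      rw [abs_of_nonneg hz] at h
      exact mul_le_mul (OrdDual.abs_apply_le_of_abs_le (hfg α) _) h (abs_nonneg _)
        ((abs_nonneg _).trans (OrdDual.abs_apply_le_of_abs_le (hfg α) _))
    rw [sub_zero]
    exact abs_le'.2 ⟨fun z hz => (le_abs_self _).trans (key z hz),
      fun z hz => (neg_le_abs _).trans (key z hz)⟩

/-! ### Arens extensions of operators of finite type -/

/-- The iterated Arens construction on a sum of products of functionals. -/
theorem arensForm_eq_sum {κ : Type*} [Fintype κ] : ∀ (n : ℕ) (G : Fin n → Type u)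
    [∀ i, AddCommGroup (G i)] [∀ i, Lattice (G i)] [∀ i, IsOrderedAddMonoid (G i)]
    [∀ i, Module ℝ (G i)] [∀ i, IsOrderedModule ℝ (G i)] (B : RegularMultilinear G ℝ)
    (φ : κ → ∀ i, OrdDual (G i)) (c : κ → ℝ),
    (∀ x, B.1 x = ∑ j, (∏ i, φ j i (x i)) * c j) →
    ∀ x'' : ∀ i, OrdDual (OrdDual (G i)),
      arensForm n G B x'' = ∑ j, (∏ i, x'' i (φ j i)) * c j := by
  intro n
  induction n with
  | zero =>
    intro G _ _ _ _ _ B φ c hB x''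
    rw [arensForm_zero, hB]
    simp
  | succ n ih =>
    intro G _ _ _ _ _ B φ c hB x''
    -- One Arens step keeps the form a sum of products: the first functional is consumed, and its
    -- value `x'' 0 (φ j 0)` is absorbed into the scalar coefficient.
    rw [arensForm_succ, ih _ _ (fun j i => φ j i.succ) (fun j => x'' 0 (φ j 0) * c j)]
    · refine Finset.sum_congr rfl fun j _ => ?_
      rw [Fin.prod_univ_succ]
      ring
    · intro x
      -- With the remaining variables fixed, the slice lies in the span of the `φ j 0`, so linearity
      -- of `x'' 0` alone evaluates it.
      have h : firstVar B x = ∑ j, ((∏ i : Fin n, φ j i.succ (x i)) * c j) • φ j 0 := by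
        ext t
        rw [firstVar_apply, hB, OrdDual.sum_apply]
        refine Finset.sum_congr rfl fun j _ => ?_
        rw [Fin.prod_univ_succ, OrdDual.smul_apply]
        simp only [Fin.cons_zero, Fin.cons_succ]
        ring
      rw [arensStep_apply, h, map_sum]
      refine Finset.sum_congr rfl fun j _ => ?_
      rw [map_smul, smul_eq_mul]
      ring

section Arens

variable {m : ℕ} {E : Fin m → Type u} [∀ i, AddCommGroup (E i)] [∀ i, Lattice (E i)]
  [∀ i, IsOrderedAddMonoid (E i)] [∀ i, Module ℝ (E i)] [∀ i, IsOrderedModule ℝ (E i)]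
  {F : Type v} [AddCommGroup F] [Lattice F] [IsOrderedAddMonoid F] [Module ℝ F]
  [IsOrderedModule ℝ F]

theorem permutedForm_eq_sum {κ : Type*} [Fintype κ] (ρ : Equiv.Perm (Fin m))
    {A : MultilinearMap ℝ E F} {φ : κ → ∀ i, OrdDual (E i)} {y : κ → F}
    (hA : ∀ x, A x = ∑ j, (∏ i, φ j i (x i)) • y j) (y' : OrdDual F) (x : ∀ k, E (ρ k)) :
    permutedForm ρ A y' x = ∑ j, (∏ k, φ j (ρ k) (x k)) * y' (y j) := by
  -- Every tuple in the permuted spaces is a reindexed tuple `z`; this form lets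
  -- `permutedForm_apply` apply without transport along `ρ`.
  obtain ⟨z, rfl⟩ : ∃ z : ∀ i, E i, (fun k => z (ρ k)) = x :=
    ⟨(ρ.symm.piCongrLeft' E).symm x, (ρ.symm.piCongrLeft' E).apply_symm_apply x⟩
  rw [permutedForm_apply, hA, map_sum]
  refine Finset.sum_congr rfl fun j _ => ?_
  rw [map_smul, smul_eq_mul, Equiv.prod_comp ρ fun i => φ j i (z i)]

/-- Every Arens extension of an operator of finite type is given by the same formula. -/
theorem arensExtension_eq_sum {κ : Type*} [Fintype κ] (ρ : Equiv.Perm (Fin m))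
    {A : RegularMultilinear E F} {φ : κ → ∀ i, OrdDual (E i)} {y : κ → F}
    (hA : ∀ x, A.1 x = ∑ j, (∏ i, φ j i (x i)) • y j) (x'' : ∀ i, OrdDual (OrdDual (E i))) :
    (arensExtension ρ A).1 x'' = ∑ j, (∏ i, x'' i (φ j i)) • OrdDual.eval (y j) := by
  ext y'
  rw [arensExtension_apply, arensForm_eq_sum m _ _ (fun j k => φ j (ρ k)) (fun j => y' (y j))
    (permutedForm_eq_sum ρ hA y'), OrdDual.sum_apply]
  refine Finset.sum_congr rfl fun j _ => ?_
  -- Reindexing the product by `ρ` is what makes the right-hand side independent of the permutation.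
  rw [OrdDual.smul_apply, OrdDual.eval_apply, Equiv.prod_comp ρ fun i => x'' i (φ j i)]

end Arens

end Riesz

/-! ### The corollary -/

theorem mainTheorem4 {m : ℕ} {E : Fin m → Type u} [∀ i, AddCommGroup (E i)]
    [∀ i, Lattice (E i)] [∀ i, IsOrderedAddMonoid (E i)] [∀ i, Module ℝ (E i)]
    [∀ i, IsOrderedModule ℝ (E i)]
    {F : Type v} [AddCommGroup F] [Lattice F] [IsOrderedAddMonoid F] [Module ℝ F]
    [IsOrderedModule ℝ F]
    (A : Riesz.RegularMultilinear E F) (hA : Riesz.IsFiniteType A) :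
    (∀ ρ σ : Equiv.Perm (Fin m), Riesz.arensExtension ρ A = Riesz.arensExtension σ A) ∧
    ∀ ρ : Equiv.Perm (Fin m),
      Riesz.IsFiniteType (Riesz.arensExtension ρ A) ∧
      Riesz.IsSeparatelyOrderContinuous.{u, v, w} (Riesz.arensExtension ρ A).1 := by
  obtain ⟨n, φ, y, h⟩ := hA
  refine ⟨fun ρ σ => Subtype.ext (MultilinearMap.ext fun x'' => ?_), fun ρ => ⟨?_, ?_⟩⟩
  · rw [Riesz.arensExtension_eq_sum ρ h, Riesz.arensExtension_eq_sum σ h]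
  · exact ⟨n, fun j i => Riesz.OrdDual.eval (φ j i), fun j => Riesz.OrdDual.eval (y j),
      Riesz.arensExtension_eq_sum ρ h⟩
  · intro i x''
    -- As a function of the `i`-th variable, the `j`-th summand is evaluation at `φ j i` times a
    -- fixed vector; the factors from the other variables are moved into that vector.
    refine Riesz.isOrderContinuous_of_eq_sum _ (fun j => φ j i)
      (fun j => (∏ k ∈ Finset.univ.erase i, x'' k (φ j k)) • Riesz.OrdDual.eval (y j)) fun t => ?_
    rw [MultilinearMap.toLinearMap_apply, Riesz.arensExtension_eq_sum ρ h]
    refine Finset.sum_congr rfl fun j _ => ?_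
    -- Splitting off the `i`-th factor isolates `t`; the remaining factors do not see the updated
    -- coordinate.
    rw [← Finset.mul_prod_erase _ _ (Finset.mem_univ i), Function.update_self, smul_smul]
    congr 2
    refine Finset.prod_congr rfl fun k hk => ?_
    rw [Function.update_of_ne (Finset.ne_of_mem_erase hk)]
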